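/- Let $A$ and $B$ be lattices with zero (least element). For $a\in A$ and $b\in B$ put $a\mathbin{\square}b=\{(x,y)\in A\times B : x\le a \text{ or } y\le b\}$ and $a\boxtimes b=\{(x,y)\in A\times B : (x\le a\text{ and }y\le b)\text{ or }x=0_A\text{ or }y=0_B\}$. The box product $A\mathbin{\square}B$ is the set of all intersections $\bigcap_{i<n}(a_i\mathbin{\square}b_i)$ with $n>0$, $a_i\in A$, $b_i\in B$, and the lattice tensor product $A\boxtimes B$ is the set of all $H\in A\mathbin{\square}B$ such that $H\subseteq a\boxtimes b$ for some $(a,b)\in A\times B$; ordered by containment, $A\boxtimes B$ is a lattice, and it contains every $a\boxtimes b$. For a lattice $L$, let $\mathrm{Con}_c\,L$ be the $\{\vee,0\}$-semilattice of compact elements of the congruence lattice of $L$, and let $\Theta_L(u,v)$ be the principal congruence of $L$ generated by $(u,v)$. For $\{\vee,0\}$-semilattices $S$ and $T$, a bi-ideal of $S\times T$ is a hereditary subset that contains all pairs $(s,0)$ and $(0,t)$, contains $(s_0\vee s_1,t)$ whenever it contains $(s_0,t)$ and $(s_1,t)$, and contains $(s,t_0\vee t_1)$ whenever it contains $(s,t_0)$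 and $(s,t_1)$. The tensor product $S\otimes T$ is the $\{\vee,0\}$-semilattice of compact elements of the complete lattice of all bi-ideals of $S\times T$ under containment, and $s\otimes t\in S\otimes T$ is the least bi-ideal containing $(s,t)$, namely $\{(x,y): (x\le s\text{ and }y\le t)\text{ or }x=0\text{ or }y=0\}$. Then there exists a unique isomorphism $\mu$ from $\mathrm{Con}_c A\otimes\mathrm{Con}_c B$ onto $\mathrm{Con}_c(A\boxtimes B)$ such that, for all $a_0\le a_1$ in $A$ and all $b_0\le b_1$ in $B$, $$\mu\bigl(\Theta_A(a_0,a_1)\otimes\Theta_B(b_0,b_1)\bigr)= \Theta_{A\boxtimes B}\bigl((a_0\boxtimes b_1)\vee(a_1\boxtimes b_0),\ a_1\boxtimes b_1\bigr),$$ where the join is taken in the lattice $A\boxtimes B$. -/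

import Mathlib

namespace LatTensor

universe u v

/-! ### Compact elements of a complete lattice -/

/-- The compact elements of a complete lattice `P`, ordered as in `P`. -/
def CompactElts (P : Type u) [CompleteLattice P] : Type u := {k : P // IsCompactElement k}

namespace CompactElts

variable {P : Type u} [CompleteLattice P]

instance : PartialOrder (CompactElts P) :=
  inferInstanceAs (PartialOrder {k : P // IsCompactElement k})

theorem isCompactElement_sup {x y : P} (hx : IsCompactElement x) (hy : IsCompactElement y) :
    IsCompactElement (x ⊔ y) := by
  intro s u hs hd hu hle
  obtain ⟨a, ha, hxa⟩ := hx s u hs hd hu (le_sup_left.trans hle)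
  obtain ⟨b, hb, hyb⟩ := hy s u hs hd hu (le_sup_right.trans hle)
  obtain ⟨c, hc, hac, hbc⟩ := hd a ha b hb
  exact ⟨c, hc, sup_le (hxa.trans hac) (hyb.trans hbc)⟩

theorem isCompactElement_bot : IsCompactElement (⊥ : P) := by
  intro s u hs _ _ _
  obtain ⟨a, ha⟩ := hs
  exact ⟨a, ha, bot_le⟩

/-- The compact elements form a join-semilattice; the join is the one of `P`. -/
instance : SemilatticeSup (CompactElts P) where
  sup x y := ⟨x.1 ⊔ y.1, isCompactElement_sup x.2 y.2⟩
  le_sup_left x y := (le_sup_left : x.1 ≤ x.1 ⊔ y.1)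
  le_sup_right x y := (le_sup_right : y.1 ≤ x.1 ⊔ y.1)
  sup_le x y z hxz hyz := (sup_le (show x.1 ≤ z.1 from hxz) hyz : x.1 ⊔ y.1 ≤ z.1)

/-- The zero of the join-semilattice of compact elements is the zero of `P`. -/
instance : OrderBot (CompactElts P) where
  bot := ⟨⊥, isCompactElement_bot⟩
  bot_le x := (bot_le : ⊥ ≤ x.1)

end CompactElts

/-! ### Congruence lattices of lattices -/

section Con

variable {L : Type u} [Lattice L]

theorem con_ext {c d : LatticeCon L} (h : ∀ x y, c.r x y ↔ d.r x y) : c = d := by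
  obtain ⟨⟨r, _⟩, _, _⟩ := c
  obtain ⟨⟨s, _⟩, _, _⟩ := d
  have : r = s := by
    funext x y
    exact propext (h x y)
  subst this
  rfl

/-- Congruences are ordered by containment. -/
instance : PartialOrder (LatticeCon L) where
  le c d := ∀ x y, c.r x y → d.r x y
  le_refl _ _ _ h := h
  le_trans _ _ _ h₁ h₂ x y h := h₂ x y (h₁ x y h)
  le_antisymm _ _ h₁ h₂ := con_ext fun x y => ⟨h₁ x y, h₂ x y⟩

/-- The infimum of a set of congruences is their intersection. -/
instance : InfSet (LatticeCon L) where
  sInf S :=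
    { r := fun x y => ∀ c ∈ S, c.r x y
      iseqv :=
        { refl := fun x c _ => c.refl x
          symm := fun h c hc => c.symm (h c hc)
          trans := fun h₁ h₂ c hc => c.trans (h₁ c hc) (h₂ c hc) }
      inf := fun h₁ h₂ c hc => c.inf (h₁ c hc) (h₂ c hc)
      sup := fun h₁ h₂ c hc => c.sup (h₁ c hc) (h₂ c hc) }

/-- The congruence lattice `Con L`. -/
instance : CompleteLattice (LatticeCon L) :=
  completeLatticeOfInf (LatticeCon L) fun _ =>
    ⟨fun c hc _ _ h => h c hc, fun _ hd _ _ h c hc => hd hc _ _ h⟩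

/-- The principal congruence generated by the pair `(a, b)`: the least congruence that
identifies `a` and `b`. -/
def principalCon (a b : L) : LatticeCon L := sInf {c | c.r a b}

theorem principalCon_le_iff {a b : L} {c : LatticeCon L} : principalCon a b ≤ c ↔ c.r a b :=
  ⟨fun h => h a b fun _ hd => hd, fun h _ _ hxy => hxy c h⟩

/-- The union of a nonempty directed set of congruences. -/
def directedUnionCon (s : Set (LatticeCon L)) (hs : s.Nonempty) (hd : DirectedOn (· ≤ ·) s) :
    LatticeCon L where
  r x y := ∃ c ∈ s, c.r x y
  iseqv :=
    { refl := fun x => hs.elim fun c hc => ⟨c, hc, c.refl x⟩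
      symm := fun ⟨c, hc, h⟩ => ⟨c, hc, c.symm h⟩
      trans := fun ⟨c, hc, h⟩ ⟨d, hd', h'⟩ =>
        let ⟨e, he, hce, hde⟩ := hd c hc d hd'
        ⟨e, he, e.trans (hce _ _ h) (hde _ _ h')⟩ }
  inf := fun ⟨c, hc, h⟩ ⟨d, hd', h'⟩ =>
    let ⟨e, he, hce, hde⟩ := hd c hc d hd'
    ⟨e, he, e.inf (hce _ _ h) (hde _ _ h')⟩
  sup := fun ⟨c, hc, h⟩ ⟨d, hd', h'⟩ =>
    let ⟨e, he, hce, hde⟩ := hd c hc d hd'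
    ⟨e, he, e.sup (hce _ _ h) (hde _ _ h')⟩

theorem isCompactElement_principalCon (a b : L) : IsCompactElement (principalCon a b) := by
  intro s u hs hd hu hle
  have h : u ≤ directedUnionCon s hs hd := hu.2 fun c hc x y hxy => ⟨c, hc, hxy⟩
  obtain ⟨c, hc, hab⟩ := h a b (principalCon_le_iff.1 hle)
  exact ⟨c, hc, principalCon_le_iff.2 hab⟩

variable (L) in
/-- `Con_c L`: the `{∨, 0}`-semilattice of compact congruences of the lattice `L`. -/
abbrev ConC : Type u := CompactElts (LatticeCon L)

/-- `Θ_L(a, b)`, as a compact congruence of `L`. -/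
def Theta (a b : L) : ConC L := ⟨principalCon a b, isCompactElement_principalCon a b⟩

end Con

/-! ### The tensor product of `{∨, 0}`-semilattices -/

section SemilatticeTensor

/-- Bi-ideals of `S × T`, for join-semilattices `S` and `T` with zero. -/
@[ext]
structure BiIdeal (S : Type u) (T : Type v) [SemilatticeSup S] [OrderBot S]
    [SemilatticeSup T] [OrderBot T] where
  carrier : Set (S × T)
  bot_left : ∀ t : T, (⊥, t) ∈ carrier
  bot_right : ∀ s : S, (s, ⊥) ∈ carrier
  hereditary : ∀ p q : S × T, p ≤ q → q ∈ carrier → p ∈ carrier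
  sup_left : ∀ (s₀ s₁ : S) (t : T), (s₀, t) ∈ carrier → (s₁, t) ∈ carrier →
    (s₀ ⊔ s₁, t) ∈ carrier
  sup_right : ∀ (s : S) (t₀ t₁ : T), (s, t₀) ∈ carrier → (s, t₁) ∈ carrier →
    (s, t₀ ⊔ t₁) ∈ carrier

variable {S : Type u} {T : Type v} [SemilatticeSup S] [OrderBot S] [SemilatticeSup T] [OrderBot T]

/-- Bi-ideals are ordered by containment. -/
instance : PartialOrder (BiIdeal S T) where
  le I J := I.carrier ⊆ J.carrier
  le_refl _ _ h := h
  le_trans _ _ _ h₁ h₂ _ h := h₂ (h₁ h)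
  le_antisymm _ _ h₁ h₂ := BiIdeal.ext (Set.Subset.antisymm h₁ h₂)

/-- The infimum of a set of bi-ideals is their intersection. -/
instance : InfSet (BiIdeal S T) where
  sInf X :=
    { carrier := {p | ∀ I ∈ X, p ∈ I.carrier}
      bot_left := fun t I _ => I.bot_left t
      bot_right := fun s I _ => I.bot_right s
      hereditary := fun p q hpq hq I hI => I.hereditary p q hpq (hq I hI)
      sup_left := fun s₀ s₁ t h₀ h₁ I hI => I.sup_left s₀ s₁ t (h₀ I hI) (h₁ I hI)
      sup_right := fun s t₀ t₁ h₀ h₁ I hI => I.sup_right s t₀ t₁ (h₀ I hI) (h₁ I hI) }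

/-- The complete lattice of all bi-ideals of `S × T` (the extended tensor product). -/
instance : CompleteLattice (BiIdeal S T) :=
  completeLatticeOfInf (BiIdeal S T) fun _ =>
    ⟨fun I hI _ h => h I hI, fun _ hJ _ h _ hI => hJ hI h⟩

/-- The bi-ideal `{(x, y) | x ≤ s and y ≤ t} ∪ {(x, y) | x = 0 or y = 0}`. -/
def pureBiIdeal (s : S) (t : T) : BiIdeal S T where
  carrier := {p | (p.1 ≤ s ∧ p.2 ≤ t) ∨ p.1 = ⊥ ∨ p.2 = ⊥}
  bot_left _ := Or.inr (Or.inl rfl)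
  bot_right _ := Or.inr (Or.inr rfl)
  hereditary p q hpq hq := by
    rcases hq with h | h | h
    · exact Or.inl ⟨hpq.1.trans h.1, hpq.2.trans h.2⟩
    · exact Or.inr (Or.inl (le_bot_iff.1 (h ▸ hpq.1)))
    · exact Or.inr (Or.inr (le_bot_iff.1 (h ▸ hpq.2)))
  sup_left s₀ s₁ t' h₀ h₁ := by
    simp only [Set.mem_ofPred_eq] at h₀ h₁ ⊢
    rcases h₀ with h₀ | h₀ | h₀
    · rcases h₁ with h₁ | h₁ | h₁
      · exact Or.inl ⟨sup_le h₀.1 h₁.1, h₀.2⟩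
      · exact Or.inl ⟨sup_le h₀.1 (h₁ ▸ bot_le), h₀.2⟩
      · exact Or.inr (Or.inr h₁)
    · subst h₀
      simpa using h₁
    · exact Or.inr (Or.inr h₀)
  sup_right s' t₀ t₁ h₀ h₁ := by
    simp only [Set.mem_ofPred_eq] at h₀ h₁ ⊢
    rcases h₀ with h₀ | h₀ | h₀
    · rcases h₁ with h₁ | h₁ | h₁
      · exact Or.inl ⟨h₀.1, sup_le h₀.2 h₁.2⟩
      · exact Or.inr (Or.inl h₁)
      · exact Or.inl ⟨h₀.1, sup_le h₀.2 (h₁ ▸ bot_le)⟩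
    · exact Or.inr (Or.inl h₀)
    · subst h₀
      simpa using h₁

theorem pureBiIdeal_le_iff {s : S} {t : T} {I : BiIdeal S T} :
    pureBiIdeal s t ≤ I ↔ (s, t) ∈ I.carrier := by
  refine ⟨fun h => h (Or.inl ⟨le_rfl, le_rfl⟩), fun h p hp => ?_⟩
  obtain ⟨x, y⟩ := p
  rcases hp with hp | hp | hp
  · exact I.hereditary _ _ (show (x, y) ≤ (s, t) from hp) h
  · exact (show x = ⊥ from hp) ▸ I.bot_left y
  · exact (show y = ⊥ from hp) ▸ I.bot_right x

/-- The union of a nonempty directed set of bi-ideals. -/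
def directedUnionBiIdeal (X : Set (BiIdeal S T)) (hX : X.Nonempty)
    (hd : DirectedOn (· ≤ ·) X) : BiIdeal S T where
  carrier := {p | ∃ I ∈ X, p ∈ I.carrier}
  bot_left t := hX.elim fun I hI => ⟨I, hI, I.bot_left t⟩
  bot_right s := hX.elim fun I hI => ⟨I, hI, I.bot_right s⟩
  hereditary := fun p q hpq ⟨I, hI, hq⟩ => ⟨I, hI, I.hereditary p q hpq hq⟩
  sup_left := fun s₀ s₁ t ⟨I, hI, h₀⟩ ⟨J, hJ, h₁⟩ =>
    let ⟨K, hK, hIK, hJK⟩ := hd I hI J hJ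
    ⟨K, hK, K.sup_left s₀ s₁ t (hIK h₀) (hJK h₁)⟩
  sup_right := fun s t₀ t₁ ⟨I, hI, h₀⟩ ⟨J, hJ, h₁⟩ =>
    let ⟨K, hK, hIK, hJK⟩ := hd I hI J hJ
    ⟨K, hK, K.sup_right s t₀ t₁ (hIK h₀) (hJK h₁)⟩

theorem isCompactElement_pureBiIdeal (s : S) (t : T) : IsCompactElement (pureBiIdeal s t) := by
  intro X u hX hd hu hle
  have h : u ≤ directedUnionBiIdeal X hX hd := hu.2 fun I hI p hp => ⟨I, hI, hp⟩
  obtain ⟨I, hI, hst⟩ := h (pureBiIdeal_le_iff.1 hle)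
  exact ⟨I, hI, pureBiIdeal_le_iff.2 hst⟩

variable (S T) in
/-- The tensor product `S ⊗ T` of join-semilattices with zero: the `{∨, 0}`-semilattice of
compact elements of the lattice of all bi-ideals of `S × T`. -/
abbrev SemilatticeTensor : Type (max u v) := CompactElts (BiIdeal S T)

/-- The pure tensor `s ⊗ t` in `S ⊗ T`. -/
def tmul (s : S) (t : T) : SemilatticeTensor S T :=
  ⟨pureBiIdeal s t, isCompactElement_pureBiIdeal s t⟩

end SemilatticeTensor

/-! ### Box products and lattice tensor products -/

section Box

variable {A : Type u} {B : Type v} [Lattice A] [Lattice B]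

/-- The pure box `a □ b`. -/
def box (a : A) (b : B) : Set (A × B) := {p | p.1 ≤ a ∨ p.2 ≤ b}

/-- Membership in the box product `A □ B`: being an intersection of finitely many, and at least
one, pure boxes. -/
def MemBoxProd (H : Set (A × B)) : Prop :=
  ∃ s : Finset (A × B), s.Nonempty ∧ H = {p | ∀ q ∈ s, p ∈ box q.1 q.2}

/-- The box closure of a subset of `A × B`. -/
def boxCl (X : Set (A × B)) : Set (A × B) :=
  {p | ∀ (a : A) (b : B), X ⊆ box a b → p ∈ box a b}

theorem subset_boxCl (X : Set (A × B)) : X ⊆ boxCl X := fun _ hp _ _ h => h hp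

theorem boxCl_subset {X H : Set (A × B)} (hH : MemBoxProd H) (h : X ⊆ H) : boxCl X ⊆ H := by
  obtain ⟨s, _, rfl⟩ := hH
  exact fun p hp q hq => hp q.1 q.2 fun x hx => h hx q hq

theorem memBoxProd_box (a : A) (b : B) : MemBoxProd (box a b) :=
  ⟨{(a, b)}, by simp, by simp⟩

theorem MemBoxProd.inter {H K : Set (A × B)} (hH : MemBoxProd H) (hK : MemBoxProd K) :
    MemBoxProd (H ∩ K) := by
  classical
  obtain ⟨s, hs, rfl⟩ := hH
  obtain ⟨t, _, rfl⟩ := hK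
  refine ⟨s ∪ t, hs.mono Finset.subset_union_left, ?_⟩
  ext p
  simp only [Set.mem_inter_iff, Set.mem_ofPred_eq, Finset.mem_union]
  exact ⟨fun h q hq => hq.elim (h.1 q) (h.2 q),
    fun h => ⟨fun q hq => h q (Or.inl hq), fun q hq => h q (Or.inr hq)⟩⟩

variable [OrderBot A] [OrderBot B]

/-- The pure lattice tensor `a ⊠ b`, for lattices with zero:
`{(x, y) | x ≤ a and y ≤ b} ∪ {(x, y) | x = 0 or y = 0}`. -/
def pureTensor (a : A) (b : B) : Set (A × B) :=
  {p | (p.1 ≤ a ∧ p.2 ≤ b) ∨ p.1 = ⊥ ∨ p.2 = ⊥}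

/-- A subset of `A × B` is confined if it is contained in some pure lattice tensor. -/
def Confined (X : Set (A × B)) : Prop := ∃ (a : A) (b : B), X ⊆ pureTensor a b

theorem pureTensor_eq (a : A) (b : B) : pureTensor a b = box a ⊥ ∩ box ⊥ b := by
  ext ⟨x, y⟩
  simp only [pureTensor, box, Set.mem_ofPred_eq, Set.mem_inter_iff, le_bot_iff]
  constructor
  · rintro (⟨h₁, h₂⟩ | rfl | rfl)
    · exact ⟨Or.inl h₁, Or.inr h₂⟩
    · exact ⟨Or.inl bot_le, Or.inl rfl⟩
    · exact ⟨Or.inr rfl, Or.inr bot_le⟩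
  · tauto

theorem memBoxProd_pureTensor (a : A) (b : B) : MemBoxProd (pureTensor a b) :=
  pureTensor_eq a b ▸ (memBoxProd_box a ⊥).inter (memBoxProd_box ⊥ b)

theorem pureTensor_mono {a a' : A} {b b' : B} (ha : a ≤ a') (hb : b ≤ b') :
    pureTensor a b ⊆ pureTensor a' b' := by
  rintro p (h | h)
  · exact Or.inl ⟨h.1.trans ha, h.2.trans hb⟩
  · exact Or.inr h

theorem pureTensor_subset_box {a a' : A} {b b' : B} :
    pureTensor a b ⊆ box a' b' ↔ a ≤ a' ∨ b ≤ b' := by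
  constructor
  · intro h
    exact h (show (a, b) ∈ pureTensor a b from Or.inl ⟨le_rfl, le_rfl⟩)
  · rintro h p (hp | hp | hp)
    · exact h.imp hp.1.trans hp.2.trans
    · exact Or.inl (hp ▸ bot_le)
    · exact Or.inr (hp ▸ bot_le)

/-- The union of finitely many pure lattice tensors. -/
def unionTensor (F : Finset (A × B)) : Set (A × B) := {p | ∃ q ∈ F, p ∈ pureTensor q.1 q.2}

theorem exists_unionTensor_of_confined {H : Set (A × B)} (hH : MemBoxProd H) (hc : Confined H) :
    ∃ F : Finset (A × B), H = unionTensor F := by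
  classical
  obtain ⟨s, _, rfl⟩ := hH
  obtain ⟨a, b, hab⟩ := hc
  suffices h : ∀ s : Finset (A × B), ∃ F : Finset (A × B),
      {p | ∀ q ∈ s, p ∈ box q.1 q.2} ∩ pureTensor a b = unionTensor F by
    obtain ⟨F, hF⟩ := h s
    exact ⟨F, by rw [← hF, Set.inter_eq_left.2 hab]⟩
  intro s
  induction s using Finset.induction_on with
  | empty => exact ⟨{(a, b)}, by ext p; simp [unionTensor]⟩
  | insert q s _ ih =>
    obtain ⟨F, hF⟩ := ih
    refine ⟨F.image (fun f => (f.1 ⊓ q.1, f.2)) ∪ F.image (fun f => (f.1, f.2 ⊓ q.2)), ?_⟩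
    have e : {p : A × B | ∀ r ∈ insert q s, p ∈ box r.1 r.2} ∩ pureTensor a b
        = box q.1 q.2 ∩ unionTensor F := by
      rw [← hF]
      ext p
      simp only [Finset.mem_insert, forall_eq_or_imp, Set.mem_inter_iff, Set.mem_ofPred_eq]
      tauto
    rw [e]
    ext p
    simp only [unionTensor, Set.mem_inter_iff, Set.mem_ofPred_eq, Finset.mem_union,
      Finset.mem_image]
    constructor
    · rintro ⟨hq, f, hf, hp⟩
      rcases hq with hq | hq
      · refine ⟨_, Or.inl ⟨f, hf, rfl⟩, ?_⟩
        exact hp.imp (fun h => ⟨le_inf h.1 hq, h.2⟩) id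
      · refine ⟨_, Or.inr ⟨f, hf, rfl⟩, ?_⟩
        exact hp.imp (fun h => ⟨h.1, le_inf h.2 hq⟩) id
    · rintro ⟨_, ⟨f, hf, rfl⟩ | ⟨f, hf, rfl⟩, hp⟩
      · exact ⟨pureTensor_subset_box.2 (Or.inl inf_le_right) hp, f, hf,
          pureTensor_mono inf_le_left le_rfl hp⟩
      · exact ⟨pureTensor_subset_box.2 (Or.inr inf_le_right) hp, f, hf,
          pureTensor_mono le_rfl inf_le_left hp⟩

theorem memBoxProd_boxCl_unionTensor (F : Finset (A × B)) :
    MemBoxProd (boxCl (unionTensor F)) := by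
  classical
  have sub : ∀ a b, unionTensor F ⊆ box a b ↔ ∀ f ∈ F, f.1 ≤ a ∨ f.2 ≤ b := by
    intro a b
    constructor
    · exact fun h f hf => pureTensor_subset_box.1 fun p hp => h ⟨f, hf, hp⟩
    · rintro h p ⟨f, hf, hp⟩
      exact pureTensor_subset_box.2 (h f hf) hp
  refine ⟨F.powerset.image fun X => (X.sup Prod.fst, (F \ X).sup Prod.snd),
    ⟨_, Finset.mem_image_of_mem _ (Finset.empty_mem_powerset F)⟩, ?_⟩
  ext p
  simp only [boxCl, Set.mem_ofPred_eq, Finset.mem_image, Finset.mem_powerset]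
  constructor
  · rintro h _ ⟨X, hX, rfl⟩
    refine h _ _ ((sub _ _).2 fun f hf => ?_)
    by_cases hfX : f ∈ X
    · exact Or.inl (Finset.le_sup (f := Prod.fst) hfX)
    · exact Or.inr (Finset.le_sup (f := Prod.snd) (Finset.mem_sdiff.2 ⟨hf, hfX⟩))
  · intro h a b hab
    rw [sub] at hab
    refine (h _ ⟨F.filter fun f => f.1 ≤ a, Finset.filter_subset _ _, rfl⟩).imp
      (fun hp => hp.trans ?_) (fun hp => hp.trans ?_)
    · exact Finset.sup_le fun f hf => (Finset.mem_filter.1 hf).2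
    · refine Finset.sup_le fun f hf => ?_
      rw [Finset.mem_sdiff, Finset.mem_filter, not_and] at hf
      exact (hab f hf.1).resolve_left (hf.2 hf.1)

theorem Confined.union {H K : Set (A × B)} (hH : Confined H) (hK : Confined K) :
    Confined (H ∪ K) := by
  obtain ⟨a, b, h⟩ := hH
  obtain ⟨c, d, k⟩ := hK
  exact ⟨a ⊔ c, b ⊔ d, Set.union_subset (h.trans (pureTensor_mono le_sup_left le_sup_left))
    (k.trans (pureTensor_mono le_sup_right le_sup_right))⟩

theorem Confined.boxCl {H : Set (A × B)} (hH : Confined H) : Confined (boxCl H) := by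
  obtain ⟨a, b, h⟩ := hH
  exact ⟨a, b, boxCl_subset (memBoxProd_pureTensor a b) h⟩

theorem memBoxProd_boxCl_union {H K : Set (A × B)} (hH : MemBoxProd H) (cH : Confined H)
    (hK : MemBoxProd K) (cK : Confined K) : MemBoxProd (boxCl (H ∪ K)) := by
  classical
  obtain ⟨F, rfl⟩ := exists_unionTensor_of_confined hH cH
  obtain ⟨G, rfl⟩ := exists_unionTensor_of_confined hK cK
  have : unionTensor F ∪ unionTensor G = unionTensor (F ∪ G) := by
    ext p
    simp only [unionTensor, Set.mem_union, Set.mem_ofPred_eq, Finset.mem_union, or_and_right,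
      exists_or]
  rw [this]
  exact memBoxProd_boxCl_unionTensor _

variable (A B) in
/-- The lattice tensor product `A ⊠ B` of lattices with zero: all confined elements of the
box product `A □ B`. -/
def LatticeTensor : Type (max u v) := {H : Set (A × B) // MemBoxProd H ∧ Confined H}

/-- `A ⊠ B` is ordered by containment. -/
instance : PartialOrder (LatticeTensor A B) :=
  inferInstanceAs (PartialOrder {H : Set (A × B) // MemBoxProd H ∧ Confined H})

/-- `A ⊠ B` is a lattice under containment: meets are intersections, joins are box closures
of unions. -/
instance : Lattice (LatticeTensor A B) where
  inf H K := ⟨H.1 ∩ K.1, H.2.1.inter K.2.1,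
    let ⟨a, b, h⟩ := H.2.2
    ⟨a, b, Set.inter_subset_left.trans h⟩⟩
  inf_le_left H K := (Set.inter_subset_left : H.1 ∩ K.1 ⊆ H.1)
  inf_le_right H K := (Set.inter_subset_right : H.1 ∩ K.1 ⊆ K.1)
  le_inf H K M hHK hHM := (Set.subset_inter hHK hHM : H.1 ⊆ K.1 ∩ M.1)
  sup H K := ⟨boxCl (H.1 ∪ K.1), memBoxProd_boxCl_union H.2.1 H.2.2 K.2.1 K.2.2,
    (H.2.2.union K.2.2).boxCl⟩
  le_sup_left H K := (Set.subset_union_left.trans (subset_boxCl _) : H.1 ⊆ boxCl (H.1 ∪ K.1))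
  le_sup_right H K := (Set.subset_union_right.trans (subset_boxCl _) : K.1 ⊆ boxCl (H.1 ∪ K.1))
  sup_le H K M hHM hKM := (boxCl_subset M.2.1 (Set.union_subset hHM hKM) :
    boxCl (H.1 ∪ K.1) ⊆ M.1)

/-- The pure lattice tensor `a ⊠ b` as an element of `A ⊠ B`. -/
def lmul (a : A) (b : B) : LatticeTensor A B :=
  ⟨pureTensor a b, memBoxProd_pureTensor a b, a, b, subset_rfl⟩

end Box

end LatTensor

/-! Call (a₀ ⊠ b₁) ∨ (a₁ ⊠ b₀) the mixed tensor of two intervals a₀ ≤ a₁ and b₀ ≤ b₁. The map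
sending a congruence θ of A ⊠ B to the set `collapsed θ` of pairs of compact congruences is an order
isomorphism from Con(A ⊠ B) onto all bi-ideals of Con_c A × Con_c B; restricting its inverse to
compact elements gives μ.

The mixed tensor is just (a₁ ⊠ b₁) ∩ (a₀ □ b₀) (`mixed_val`). Hence, with one interval fixed, the
intervals of the other factor collapsed by θ are those of a congruence (`mixedCon`). This makes
`collapsed θ` a bi-ideal and lets principal congruences be tested on their generators
(`Theta_mem_collapsed_iff`), which is the formula for μ.

The map reflects order (`con_le_of_collapsed_subset`): elements of A ⊠ B are finite unions of pure
tensors and finite intersections of boxes, so congruences are determined by the pairs a ⊠ b and (a ⊠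
b) ∩ (c □ d), whose intersection is again a mixed tensor.

It is onto because every bi-ideal is an intersection of sets {(x, y) : x ≤ p or y ≤ q} with p, q
congruences (`exists_con_of_notMem`, which rests on distributivity of Con A), and these come from
the kernels `pairCon p q` by `pairCon_mixed_iff`.

Uniqueness holds since tensors of principal congruences determine bi-ideals. -/

namespace LatTensor

universe u v

/-! ### Congruence lattices: distributivity, ideals of compact congruences, prime congruences -/

section Congruences

variable {L : Type u} [Lattice L]

theorem con_le_of_forall_le {c d : LatticeCon L} (h : ∀ x y, x ≤ y → c.r x y → d.r x y) :
    c ≤ d := fun _ _ hxy =>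
  d.r_inf_sup_iff.1 (h _ _ inf_le_sup (c.r_inf_sup_iff.2 hxy))

theorem exists_le_of_not_le {c d : LatticeCon L} (h : ¬ c ≤ d) :
    ∃ x y, x ≤ y ∧ c.r x y ∧ ¬ d.r x y := by
  by_contra! hcd
  exact h (con_le_of_forall_le hcd)

theorem con_of_le_of_le {c : LatticeCon L} {x y z : L} (h : c.r x z) (hxy : x ≤ y)
    (hyz : y ≤ z) : c.r y z := by
  simpa [sup_eq_right.2 hxy, sup_eq_left.2 hyz] using c.sup h (c.refl y)

theorem con_inf_left {c : LatticeCon L} {x y : L} (h : c.r x y) (z : L) :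
    c.r (z ⊓ x) (z ⊓ y) := c.inf (c.refl z) h

theorem con_sup_left {c : LatticeCon L} {x y : L} (h : c.r x y) (z : L) :
    c.r (z ⊔ x) (z ⊔ y) := c.sup (c.refl z) h

theorem con_sup_right {c : LatticeCon L} {x y : L} (h : c.r x y) (z : L) :
    c.r (x ⊔ z) (y ⊔ z) := c.sup h (c.refl z)

theorem Theta_le_iff {a b : L} {c : ConC L} : Theta a b ≤ c ↔ c.1.r a b := principalCon_le_iff

theorem eqvGen_map {X Y : Type*} {r : X → X → Prop} {t : Y → Y → Prop} (ht : Equivalence t)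
    {f : X → Y} (hf : ∀ a b, r a b → t (f a) (f b)) {x y : X} (h : Relation.EqvGen r x y) :
    t (f x) (f y) := by
  induction h with
  | rel a b h => exact hf a b h
  | refl => exact ht.refl _
  | symm _ _ _ ih => exact ht.symm ih
  | trans _ _ _ _ _ ih₁ ih₂ => exact ht.trans ih₁ ih₂

/-- The equivalence generated by two congruences, as a congruence. -/
def chainCon (c d : LatticeCon L) : LatticeCon L where
  r := Relation.EqvGen fun x y => c.r x y ∨ d.r x y
  iseqv := Relation.EqvGen.is_equivalence _
  inf {_ x y _} hwx hyz :=
    (eqvGen_map (f := (· ⊓ y)) (Relation.EqvGen.is_equivalence _) (fun _ _ h => .rel _ _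
      (h.imp (fun h => c.inf h (c.refl y)) fun h => d.inf h (d.refl y))) hwx).trans _ _ _
    (eqvGen_map (f := (x ⊓ ·)) (Relation.EqvGen.is_equivalence _) (fun _ _ h => .rel _ _
      (h.imp (con_inf_left · x) (con_inf_left · x))) hyz)
  sup {_ x y _} hwx hyz :=
    (eqvGen_map (f := (· ⊔ y)) (Relation.EqvGen.is_equivalence _) (fun _ _ h => .rel _ _
      (h.imp (con_sup_right · y) (con_sup_right · y))) hwx).trans _ _ _
    (eqvGen_map (f := (x ⊔ ·)) (Relation.EqvGen.is_equivalence _) (fun _ _ h => .rel _ _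
      (h.imp (con_sup_left · x) (con_sup_left · x))) hyz)

theorem eqvGen_of_sup_con {c d : LatticeCon L} {x y : L} (h : (c ⊔ d).r x y) :
    Relation.EqvGen (fun x y => c.r x y ∨ d.r x y) x y :=
  (sup_le (fun _ _ h => .rel _ _ (Or.inl h)) (fun _ _ h => .rel _ _ (Or.inr h)) :
    c ⊔ d ≤ chainCon c d) x y h

theorem inf_con_r {c d : LatticeCon L} {x y : L} : (c ⊓ d).r x y ↔ c.r x y ∧ d.r x y := by
  constructor
  · exact fun h => ⟨(inf_le_left : c ⊓ d ≤ c) _ _ h, (inf_le_right : c ⊓ d ≤ d) _ _ h⟩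
  · rintro ⟨hc, hd⟩
    exact (le_inf (principalCon_le_iff.2 hc) (principalCon_le_iff.2 hd)) x y
      (principalCon_le_iff.1 le_rfl)

/-- Congruence lattices of lattices are distributive. -/
theorem con_inf_sup_le (c d e : LatticeCon L) : c ⊓ (d ⊔ e) ≤ (c ⊓ d) ⊔ (c ⊓ e) := by
  refine con_le_of_forall_le fun x y hxy h => ?_
  obtain ⟨hc, hde⟩ := inf_con_r.1 h
  set η := (c ⊓ d) ⊔ (c ⊓ e)
  -- The map a ↦ y ⊓ (x ⊔ a) pushes a chain of `d`- and `e`-steps from x to y into the interval [x,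
  -- y], all of which is one `c`-class, so each step becomes a step of c ⊓ d or c ⊓ e.
  have hcl : ∀ a b, c.r (y ⊓ (x ⊔ a)) (y ⊓ (x ⊔ b)) := by
    have key : ∀ a, c.r x (y ⊓ (x ⊔ a)) := fun a => by
      simpa using c.inf hc (c.refl (x ⊔ a))
    exact fun a b => c.trans (c.symm (key a)) (key b)
  have := eqvGen_map (f := fun a => y ⊓ (x ⊔ a)) η.iseqv (fun a b h => by
    rcases h with h | h
    · exact (le_sup_left : c ⊓ d ≤ η) _ _
        (inf_con_r.2 ⟨hcl a b, con_inf_left (con_sup_left h x) y⟩)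
    · exact (le_sup_right : c ⊓ e ≤ η) _ _
        (inf_con_r.2 ⟨hcl a b, con_inf_left (con_sup_left h x) y⟩)) (eqvGen_of_sup_con hde)
  simpa [hxy] using this

theorem Theta_symm_le (a b : L) : Theta b a ≤ Theta a b :=
  Theta_le_iff.2 ((Theta a b).1.symm (Theta_le_iff.1 le_rfl))

theorem Theta_trans_le (a b c : L) : Theta a c ≤ Theta a b ⊔ Theta b c :=
  Theta_le_iff.2 ((Theta a b ⊔ Theta b c).1.trans (Theta_le_iff.1 le_sup_left)
    (Theta_le_iff.1 le_sup_right))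

theorem Theta_inf_le (a b c d : L) : Theta (a ⊓ c) (b ⊓ d) ≤ Theta a b ⊔ Theta c d :=
  Theta_le_iff.2 ((Theta a b ⊔ Theta c d).1.inf (Theta_le_iff.1 le_sup_left)
    (Theta_le_iff.1 le_sup_right))

theorem Theta_sup_le (a b c d : L) : Theta (a ⊔ c) (b ⊔ d) ≤ Theta a b ⊔ Theta c d :=
  Theta_le_iff.2 ((Theta a b ⊔ Theta c d).1.sup (Theta_le_iff.1 le_sup_left)
    (Theta_le_iff.1 le_sup_right))

/-- The congruence corresponding to an ideal of the semilattice of compact congruences. -/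
def idealCon (P : Order.Ideal (ConC L)) : LatticeCon L where
  r x y := Theta x y ∈ P
  iseqv :=
    { refl := fun x => P.lower (Theta_le_iff.2 ((⊥ : ConC L).1.refl x)) P.bot_mem
      symm := fun h => P.lower (Theta_symm_le _ _) h
      trans := fun h₁ h₂ => P.lower (Theta_trans_le _ _ _) (P.sup_mem h₁ h₂) }
  inf := fun h₁ h₂ => P.lower (Theta_inf_le _ _ _ _) (P.sup_mem h₁ h₂)
  sup := fun h₁ h₂ => P.lower (Theta_sup_le _ _ _ _) (P.sup_mem h₁ h₂)

/-- `idealCon P` is the directed join of the members of `P`, so a compact congruence below it lies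
below some member. -/
theorem le_idealCon_iff {P : Order.Ideal (ConC L)} {c : ConC L} :
    c.1 ≤ idealCon P ↔ c ∈ P := by
  constructor
  · intro h
    have hdir : DirectedOn (· ≤ ·) ((fun d : ConC L => d.1) '' P) := by
      rintro _ ⟨d, hd, rfl⟩ _ ⟨e, he, rfl⟩
      exact ⟨_, ⟨d ⊔ e, P.sup_mem hd he, rfl⟩, (le_sup_left : d ≤ d ⊔ e),
        (le_sup_right : e ≤ d ⊔ e)⟩
    have hlub : IsLUB ((fun d : ConC L => d.1) '' P) (idealCon P) := by
      refine ⟨?_, fun u hu x y hxy => principalCon_le_iff.1 (hu ⟨Theta x y, hxy, rfl⟩)⟩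
      rintro _ ⟨d, hd, rfl⟩ x y hxy
      exact P.lower (Theta_le_iff.2 hxy) hd
    obtain ⟨_, ⟨d, hd, rfl⟩, hcd⟩ :=
      c.2 _ _ (Set.Nonempty.image _ ⟨⊥, P.bot_mem⟩) hdir hlub h
    exact P.lower (show c ≤ d from hcd) hd
  · exact fun hc x y hxy => P.lower (Theta_le_iff.2 hxy) hc

/-- A congruence not above a given compact one extends to a prime congruence with this property. -/
theorem exists_prime_con (c : ConC L) (d : LatticeCon L) (h : ¬ c.1 ≤ d) :
    ∃ p : LatticeCon L, d ≤ p ∧ ¬ c.1 ≤ p ∧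
      ∀ x y : LatticeCon L, ¬ x ≤ p → ¬ y ≤ p → ¬ x ⊓ y ≤ p := by
  have hchain : ∀ s ⊆ {p : LatticeCon L | ¬ c.1 ≤ p}, IsChain (· ≤ ·) s → ∀ y ∈ s,
      ∃ ub ∈ {p : LatticeCon L | ¬ c.1 ≤ p}, ∀ z ∈ s, z ≤ ub := by
    intro s hs hs' y hy
    have hd : DirectedOn (· ≤ ·) s := hs'.directedOn
    refine ⟨directedUnionCon s ⟨y, hy⟩ hd, fun hc => ?_, fun z hz a b hab => ⟨z, hz, hab⟩⟩
    obtain ⟨e, he, hce⟩ := c.2 s (directedUnionCon s ⟨y, hy⟩ hd) ⟨y, hy⟩ hd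
      ⟨fun z hz a b hab => ⟨z, hz, hab⟩, fun u hu a b ⟨z, hz, hab⟩ => hu hz a b hab⟩ hc
    exact hs he hce
  obtain ⟨p, hdp, hp, hmax⟩ := zorn_le_nonempty₀ _ hchain d h
  refine ⟨p, hdp, hp, fun x y hx hy hxy => hp ?_⟩
  -- By maximality of `p`; distributivity then turns (p ⊔ x) ⊓ (p ⊔ y) into p ⊔ (x ⊓ y), which is
  -- `p` if x ⊓ y ≤ p.
  have key : ∀ x, ¬ x ≤ p → c.1 ≤ p ⊔ x := fun x hx => by
    by_contra hc
    exact hx (le_sup_right.trans (hmax hc le_sup_left))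
  calc c.1 ≤ (p ⊔ x) ⊓ (p ⊔ y) := le_inf (key x hx) (key y hy)
    _ ≤ ((p ⊔ x) ⊓ p) ⊔ ((p ⊔ x) ⊓ y) := con_inf_sup_le _ _ _
    _ ≤ p := by
      refine sup_le inf_le_right ?_
      rw [inf_comm]
      refine (con_inf_sup_le _ _ _).trans (sup_le inf_le_right ?_)
      rwa [inf_comm]

end Congruences

/-! ### Separating pairs from bi-ideals by pairs of congruences -/

section BiIdealSeparation

variable {A : Type u} {B : Type v} [Lattice A] [Lattice B]

/-- Bi-ideals of compact congruences are intersections of those given by pairs of congruences. -/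
theorem exists_con_of_notMem {I : BiIdeal (ConC A) (ConC B)} {s : ConC A} {t : ConC B}
    (h : (s, t) ∉ I.carrier) :
    ∃ (p : LatticeCon A) (q : LatticeCon B), ¬ s.1 ≤ p ∧ ¬ t.1 ≤ q ∧
      ∀ x y, (x, y) ∈ I.carrier → x.1 ≤ p ∨ y.1 ≤ q := by
  let J : Order.Ideal (ConC A) :=
    { carrier := {x | (x, t) ∈ I.carrier}
      lower' := fun x y hyx hx => I.hereditary (y, t) (x, t) ⟨hyx, le_rfl⟩ hx
      nonempty' := ⟨⊥, I.bot_left t⟩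
      directed' := fun x hx y hy =>
        ⟨x ⊔ y, I.sup_left x y t hx hy, le_sup_left, le_sup_right⟩ }
  obtain ⟨p, hJp, hsp, hp⟩ := exists_prime_con s (idealCon J) (mt le_idealCon_iff.1 h)
  -- The congruence `q` has to absorb every `y` paired in `I` with some `x` not below `p`. Primeness
  -- of `p` is what makes these `y` an ideal.
  let Q : Order.Ideal (ConC B) :=
    { carrier := {y | ∃ x : ConC A, ¬ x.1 ≤ p ∧ (x, y) ∈ I.carrier}
      lower' := fun y z hzy ⟨x, hx, hxy⟩ =>
        ⟨x, hx, I.hereditary (x, z) (x, y) ⟨le_rfl, hzy⟩ hxy⟩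
      nonempty' := ⟨⊥, s, hsp, I.bot_right s⟩
      directed' := by
        rintro y ⟨x, hx, hxy⟩ z ⟨w, hw, hwz⟩
        -- The meet of `x` and `w` need not be compact; a principal congruence inside it and not
        -- below `p` serves as a common partner of `y` and `z`.
        obtain ⟨a, b, -, hab, hab'⟩ := exists_le_of_not_le (hp x.1 w.1 hx hw)
        obtain ⟨hax, haw⟩ := inf_con_r.1 hab
        refine ⟨y ⊔ z, ⟨Theta a b, mt principalCon_le_iff.1 hab', ?_⟩, le_sup_left, le_sup_right⟩
        exact I.sup_right _ _ _
          (I.hereditary (_, y) (x, y) ⟨Theta_le_iff.2 hax, le_rfl⟩ hxy)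
          (I.hereditary (_, z) (w, z) ⟨Theta_le_iff.2 haw, le_rfl⟩ hwz) }
  refine ⟨p, idealCon Q, hsp, ?_, fun x y hxy => ?_⟩
  · rw [le_idealCon_iff]
    rintro ⟨x, hx, hxt⟩
    exact hx ((le_idealCon_iff (P := J).2 hxt).trans hJp)
  · by_cases hx : x.1 ≤ p
    · exact Or.inl hx
    · exact Or.inr (le_idealCon_iff.2 ⟨x, hx, hxy⟩)

/-- A bi-ideal of compact congruences is determined by its pairs of principal congruences. -/
theorem biIdeal_le_of_Theta {I K : BiIdeal (ConC A) (ConC B)}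
    (h : ∀ (a₀ a₁ : A) (b₀ b₁ : B), a₀ ≤ a₁ → b₀ ≤ b₁ →
      (Theta a₀ a₁, Theta b₀ b₁) ∈ I.carrier → (Theta a₀ a₁, Theta b₀ b₁) ∈ K.carrier) :
    I ≤ K := by
  rintro ⟨s, t⟩ hst
  by_contra hK
  obtain ⟨p, q, hp, hq, hpq⟩ := exists_con_of_notMem hK
  obtain ⟨a₀, a₁, ha, has, hap⟩ := exists_le_of_not_le hp
  obtain ⟨b₀, b₁, hb, hbt, hbq⟩ := exists_le_of_not_le hq
  rcases hpq _ _ (h a₀ a₁ b₀ b₁ ha hb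
    (I.hereditary _ (s, t) ⟨Theta_le_iff.2 has, Theta_le_iff.2 hbt⟩ hst)) with h | h
  · exact hap (principalCon_le_iff.1 h)
  · exact hbq (principalCon_le_iff.1 h)

end BiIdealSeparation

/-! ### Pure tensors and mixed tensors -/

section Mixed

variable {A : Type u} {B : Type v} [Lattice A] [Lattice B] [OrderBot A] [OrderBot B]

/-- The union of the two pure tensors already equals the right-hand side, which is an intersection
of boxes, so the box closure adds nothing. -/
theorem mixed_val {a₀ a₁ : A} {b₀ b₁ : B} (ha : a₀ ≤ a₁) (hb : b₀ ≤ b₁) :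
    (lmul a₀ b₁ ⊔ lmul a₁ b₀).1 = pureTensor a₁ b₁ ∩ box a₀ b₀ := by
  have hsub : pureTensor a₁ b₁ ∩ box a₀ b₀ ⊆ pureTensor a₀ b₁ ∪ pureTensor a₁ b₀ := by
    rintro p ⟨hp | hp, h | h⟩
    · exact Or.inl (Or.inl ⟨h, hp.2⟩)
    · exact Or.inr (Or.inl ⟨hp.1, h⟩)
    · exact Or.inl (Or.inr hp)
    · exact Or.inl (Or.inr hp)
  refine Set.Subset.antisymm ?_ (hsub.trans (subset_boxCl _))
  refine boxCl_subset ((memBoxProd_pureTensor _ _).inter (memBoxProd_box _ _))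
    (Set.union_subset (Set.subset_inter ?_ ?_) (Set.subset_inter ?_ ?_))
  · exact pureTensor_mono ha le_rfl
  · exact pureTensor_subset_box.2 (Or.inl le_rfl)
  · exact pureTensor_mono le_rfl hb
  · exact pureTensor_subset_box.2 (Or.inr le_rfl)

theorem mixed_le {a₀ a₁ : A} {b₀ b₁ : B} (ha : a₀ ≤ a₁) (hb : b₀ ≤ b₁) :
    lmul a₀ b₁ ⊔ lmul a₁ b₀ ≤ lmul a₁ b₁ :=
  sup_le (pureTensor_mono ha le_rfl) (pureTensor_mono le_rfl hb)

theorem lmul_mono {a₀ a₁ : A} {b₀ b₁ : B} (ha : a₀ ≤ a₁) (hb : b₀ ≤ b₁) :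
    lmul a₀ b₀ ≤ lmul a₁ b₁ := pureTensor_mono ha hb

/-- `H` is the intersection of the boxes above it, and a box contains a ⊠ b as soon as it contains
the point (a, b). Bilinearity of ⊠ becomes propositional logic in this form. -/
theorem lmul_le_iff {a : A} {b : B} {H : LatticeTensor A B} :
    lmul a b ≤ H ↔ ∀ x y, H.1 ⊆ box x y → a ≤ x ∨ b ≤ y := by
  constructor
  · exact fun h x y hH => pureTensor_subset_box.1 (Set.Subset.trans h hH)
  · intro h p hp
    obtain ⟨H, ⟨s, _, rfl⟩, _⟩ := H
    exact fun q hq => pureTensor_subset_box.2 (h q.1 q.2 fun _ hr => hr q hq) hp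

theorem lmul_sup_left (a a' : A) (b : B) : lmul (a ⊔ a') b = lmul a b ⊔ lmul a' b := by
  refine le_antisymm (lmul_le_iff.2 fun x y h => ?_)
    (sup_le (lmul_mono le_sup_left le_rfl) (lmul_mono le_sup_right le_rfl))
  have h₁ := lmul_le_iff.1 (le_sup_left : lmul a b ≤ lmul a b ⊔ lmul a' b) x y h
  have h₂ := lmul_le_iff.1 (le_sup_right : lmul a' b ≤ lmul a b ⊔ lmul a' b) x y h
  rw [sup_le_iff]
  tauto

theorem lmul_sup_right (a : A) (b b' : B) : lmul a (b ⊔ b') = lmul a b ⊔ lmul a b' := by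
  refine le_antisymm (lmul_le_iff.2 fun x y h => ?_)
    (sup_le (lmul_mono le_rfl le_sup_left) (lmul_mono le_rfl le_sup_right))
  have h₁ := lmul_le_iff.1 (le_sup_left : lmul a b ≤ lmul a b ⊔ lmul a b') x y h
  have h₂ := lmul_le_iff.1 (le_sup_right : lmul a b' ≤ lmul a b ⊔ lmul a b') x y h
  rw [sup_le_iff]
  tauto

end Mixed

/-! ### Congruences induced on one factor -/

section MixedRelation

/-- The properties shared by the pairs of maps `x ↦ x ⊠ b₁`, `x ↦ x ⊠ b₀` for `b₀ ≤ b₁` and by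
their mirror images. -/
structure MixedPair {X : Type*} {L : Type*} [Lattice X] [Lattice L] (f g : X → L) : Prop where
  map_sup : ∀ x y, f (x ⊔ y) = f x ⊔ f y
  mono : Monotone g
  le : ∀ x, g x ≤ f x
  inf_eq : ∀ x y c, x ≤ c → y ≤ c → (f x ⊔ g c) ⊓ (f y ⊔ g c) = f (x ⊓ y) ⊔ g c
  inf_eq_of_le : ∀ x y c, x ≤ y → y ≤ c → (f x ⊔ g c) ⊓ f y = f x ⊔ g y

variable {X : Type*} {L : Type*} [Lattice X] [Lattice L] {f g : X → L}

theorem MixedPair.enlarge (h : MixedPair f g) {θ : LatticeCon L} {x y c d : X} (hcd : c ≤ d)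
    (hr : θ.r (f x ⊔ g c) (f y ⊔ g c)) : θ.r (f x ⊔ g d) (f y ⊔ g d) := by
  simpa [sup_assoc, sup_eq_right.2 (h.mono hcd)] using con_sup_right hr (g d)

/-- The congruence of pairs that become `θ`-congruent relative to a mixed pair of maps. -/
def mixedCon (h : MixedPair f g) (θ : LatticeCon L) : LatticeCon X where
  -- `X` need not have a top, so the bound `c` varies; it can always be enlarged, which lets two
  -- bounds be merged into their join.
  r x y := ∃ c, x ≤ c ∧ y ≤ c ∧ θ.r (f x ⊔ g c) (f y ⊔ g c)
  iseqv :=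
    { refl := fun x => ⟨x, le_rfl, le_rfl, θ.refl _⟩
      symm := fun ⟨c, hx, hy, hc⟩ => ⟨c, hy, hx, θ.symm hc⟩
      trans := fun ⟨c, hx, _, hc⟩ ⟨d, _, hz, hd⟩ =>
        ⟨c ⊔ d, le_sup_of_le_left hx, le_sup_of_le_right hz,
          θ.trans (h.enlarge le_sup_left hc) (h.enlarge le_sup_right hd)⟩ }
  inf := fun ⟨c, hw, hx, hc⟩ ⟨d, hy, hz, hd⟩ => by
    refine ⟨c ⊔ d, inf_le_of_left_le (le_sup_of_le_left hw),
      inf_le_of_left_le (le_sup_of_le_left hx), ?_⟩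
    rw [← h.inf_eq _ _ _ (le_sup_of_le_left hw) (le_sup_of_le_right hy),
      ← h.inf_eq _ _ _ (le_sup_of_le_left hx) (le_sup_of_le_right hz)]
    exact θ.inf (h.enlarge le_sup_left hc) (h.enlarge le_sup_right hd)
  sup {w x y z} := fun ⟨c, hw, hx, hc⟩ ⟨d, hy, hz, hd⟩ => by
    refine ⟨c ⊔ d, sup_le_sup hw hy, sup_le_sup hx hz, ?_⟩
    rw [h.map_sup, h.map_sup, sup_sup_distrib_right (f w), sup_sup_distrib_right (f x)]
    exact θ.sup (h.enlarge le_sup_left hc) (h.enlarge le_sup_right hd)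

theorem mixedCon_r_iff (h : MixedPair f g) {θ : LatticeCon L} {x y : X} (hxy : x ≤ y) :
    (mixedCon h θ).r x y ↔ θ.r (f x ⊔ g y) (f y) := by
  constructor
  · rintro ⟨c, _, hy, hc⟩
    -- Meeting with `f y` shrinks the bound from `c` to `y`.
    have := θ.inf hc (θ.refl (f y))
    rwa [h.inf_eq_of_le x y c hxy hy, inf_eq_right.2 le_sup_left] at this
  · intro hr
    refine ⟨y, hxy, le_rfl, ?_⟩
    rwa [sup_eq_left.2 (h.le y)]

end MixedRelation

/-! ### The bi-ideal of a congruence, and why it determines the congruence -/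

section Forward

variable {A : Type u} {B : Type v} [Lattice A] [Lattice B] [OrderBot A] [OrderBot B]

theorem mixedPair_left {b₀ b₁ : B} (hb : b₀ ≤ b₁) :
    MixedPair (fun a : A => lmul a b₁) (fun a => lmul a b₀) where
  map_sup x y := lmul_sup_left x y b₁
  mono _ _ h := lmul_mono h le_rfl
  le _ := lmul_mono le_rfl hb
  inf_eq x y c hx hy := Subtype.ext <| by
    change (lmul x b₁ ⊔ lmul c b₀).1 ∩ (lmul y b₁ ⊔ lmul c b₀).1 = _
    rw [mixed_val hx hb, mixed_val hy hb, mixed_val (inf_le_of_left_le hx) hb]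
    ext p
    simp only [box, Set.mem_inter_iff, Set.mem_ofPred_eq, le_inf_iff]
    tauto
  inf_eq_of_le x y c hxy hy := Subtype.ext <| by
    change (lmul x b₁ ⊔ lmul c b₀).1 ∩ pureTensor y b₁ = _
    rw [mixed_val (hxy.trans hy) hb, mixed_val hxy hb, Set.inter_right_comm,
      Set.inter_eq_right.2 (pureTensor_mono hy le_rfl)]

theorem mixedPair_right {a₀ a₁ : A} (ha : a₀ ≤ a₁) :
    MixedPair (fun b : B => lmul a₁ b) (fun b => lmul a₀ b) where
  map_sup x y := lmul_sup_right a₁ x y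
  mono _ _ h := lmul_mono le_rfl h
  le _ := lmul_mono ha le_rfl
  inf_eq x y c hx hy := Subtype.ext <| by
    simp only [sup_comm _ (lmul a₀ c)]
    change (lmul a₀ c ⊔ lmul a₁ x).1 ∩ (lmul a₀ c ⊔ lmul a₁ y).1 = _
    rw [mixed_val ha hx, mixed_val ha hy, mixed_val ha (inf_le_of_left_le hx)]
    ext p
    simp only [box, Set.mem_inter_iff, Set.mem_ofPred_eq, le_inf_iff]
    tauto
  inf_eq_of_le x y c hxy hy := Subtype.ext <| by
    simp only [sup_comm (lmul a₁ x)]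
    change (lmul a₀ c ⊔ lmul a₁ x).1 ∩ pureTensor a₁ y = _
    rw [mixed_val ha (hxy.trans hy), mixed_val ha hxy, Set.inter_right_comm,
      Set.inter_eq_right.2 (pureTensor_mono le_rfl hy)]

/-- The pairs `(s, t)` of compact congruences whose mixed tensors are collapsed by `θ`. -/
def collapsed (θ : LatticeCon (LatticeTensor A B)) : Set (ConC A × ConC B) :=
  {p | ∀ (a₀ a₁ : A) (b₀ b₁ : B), a₀ ≤ a₁ → b₀ ≤ b₁ → p.1.1.r a₀ a₁ → p.2.1.r b₀ b₁ →
    θ.r (lmul a₀ b₁ ⊔ lmul a₁ b₀) (lmul a₁ b₁)}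

/-- For fixed `t`, the condition on `s` is to lie below a family of congruences of `A`, hence it is
stable under joins and holds for zero. -/
theorem mem_collapsed_iff_left {θ : LatticeCon (LatticeTensor A B)} {s : ConC A} {t : ConC B} :
    (s, t) ∈ collapsed θ ↔ ∀ (b₀ b₁ : B) (hb : b₀ ≤ b₁), t.1.r b₀ b₁ →
      s.1 ≤ mixedCon (mixedPair_left hb) θ := by
  constructor
  · intro h b₀ b₁ hb ht
    exact con_le_of_forall_le fun a₀ a₁ ha hs =>
      (mixedCon_r_iff (mixedPair_left hb) ha).2 (h a₀ a₁ b₀ b₁ ha hb hs ht)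
  · intro h a₀ a₁ b₀ b₁ ha hb hs ht
    exact (mixedCon_r_iff (mixedPair_left hb) ha).1 (h b₀ b₁ hb ht _ _ hs)

theorem mem_collapsed_iff_right {θ : LatticeCon (LatticeTensor A B)} {s : ConC A} {t : ConC B} :
    (s, t) ∈ collapsed θ ↔ ∀ (a₀ a₁ : A) (ha : a₀ ≤ a₁), s.1.r a₀ a₁ →
      t.1 ≤ mixedCon (mixedPair_right ha) θ := by
  constructor
  · intro h a₀ a₁ ha hs
    refine con_le_of_forall_le fun b₀ b₁ hb ht => (mixedCon_r_iff (mixedPair_right ha) hb).2 ?_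
    rw [sup_comm]
    exact h a₀ a₁ b₀ b₁ ha hb hs ht
  · intro h a₀ a₁ b₀ b₁ ha hb hs ht
    rw [sup_comm]
    exact (mixedCon_r_iff (mixedPair_right ha) hb).1 (h a₀ a₁ ha hs _ _ ht)

/-- The bi-ideal of compact congruences attached to a congruence of `A ⊠ B`. -/
def collapsedBiIdeal (θ : LatticeCon (LatticeTensor A B)) : BiIdeal (ConC A) (ConC B) where
  carrier := collapsed θ
  bot_left _ := mem_collapsed_iff_left.2 fun _ _ _ _ =>
    (bot_le : (⊥ : LatticeCon A) ≤ _)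
  bot_right _ := mem_collapsed_iff_right.2 fun _ _ _ _ =>
    (bot_le : (⊥ : LatticeCon B) ≤ _)
  hereditary _ _ hpq hq a₀ a₁ b₀ b₁ ha hb hs ht :=
    hq a₀ a₁ b₀ b₁ ha hb (hpq.1 _ _ hs) (hpq.2 _ _ ht)
  sup_left _ _ _ h₀ h₁ := mem_collapsed_iff_left.2 fun b₀ b₁ hb ht =>
    sup_le (mem_collapsed_iff_left.1 h₀ b₀ b₁ hb ht) (mem_collapsed_iff_left.1 h₁ b₀ b₁ hb ht)
  sup_right _ _ _ h₀ h₁ := mem_collapsed_iff_right.2 fun a₀ a₁ ha hs =>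
    sup_le (mem_collapsed_iff_right.1 h₀ a₀ a₁ ha hs) (mem_collapsed_iff_right.1 h₁ a₀ a₁ ha hs)

/-- The generators suffice by varying one factor at a time: first the interval of `A` with b₀ ≤ b₁
fixed, then the interval of `B` over each new interval of `A`. Each time the collapsed intervals
come from a congruence, which contains the principal one. -/
theorem Theta_mem_collapsed_iff {θ : LatticeCon (LatticeTensor A B)} {a₀ a₁ : A} {b₀ b₁ : B}
    (ha : a₀ ≤ a₁) (hb : b₀ ≤ b₁) : (Theta a₀ a₁, Theta b₀ b₁) ∈ collapsed θ ↔
      θ.r (lmul a₀ b₁ ⊔ lmul a₁ b₀) (lmul a₁ b₁) := by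
  constructor
  · exact fun h => h a₀ a₁ b₀ b₁ ha hb (principalCon_le_iff.1 le_rfl)
      (principalCon_le_iff.1 le_rfl)
  · intro h
    refine mem_collapsed_iff_right.2 fun c₀ c₁ hc hs => principalCon_le_iff.2 ?_
    rw [mixedCon_r_iff (mixedPair_right hc) hb, sup_comm]
    exact (mixedCon_r_iff (mixedPair_left hb) hc).1
      (principalCon_le_iff.2 ((mixedCon_r_iff (mixedPair_left hb) ha).2 h) _ _ hs)

/-- Each box containing `H` cuts a ⊠ b in a mixed tensor that lies between (a ⊠ b) ∩ H and a ⊠ b.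
Convexity of classes makes `θ` collapse it, the hypothesis passes this on to `θ'`, and finitely many
cuts are then met. -/
theorem collapsed_inf_box {θ θ' : LatticeCon (LatticeTensor A B)}
    (h : collapsed θ ⊆ collapsed θ') {H : LatticeTensor A B} {a : A} {b : B}
    (hH : θ.r (lmul a b ⊓ H) (lmul a b)) (s : Finset (A × B))
    (hs : ∀ q ∈ s, H.1 ⊆ box q.1 q.2) : ∃ M : LatticeTensor A B,
      M.1 = pureTensor a b ∩ {p | ∀ q ∈ s, p ∈ box q.1 q.2} ∧ θ'.r M (lmul a b) := by
  classical
  induction s using Finset.induction_on with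
  | empty => exact ⟨lmul a b, by simp [lmul], θ'.refl _⟩
  | insert q s _ ih =>
    obtain ⟨M, hM, hMr⟩ := ih fun q hq => hs q (Finset.mem_insert_of_mem hq)
    have ha : a ⊓ q.1 ≤ a := inf_le_left
    have hb : b ⊓ q.2 ≤ b := inf_le_left
    have hval : (lmul (a ⊓ q.1) b ⊔ lmul a (b ⊓ q.2)).1 = pureTensor a b ∩ box q.1 q.2 := by
      rw [mixed_val ha hb]
      ext p
      simp only [pureTensor, box, Set.mem_inter_iff, Set.mem_ofPred_eq, le_inf_iff]
      constructor
      · tauto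
      · rintro ⟨h | h | h, h'⟩
        · tauto
        · simp [h]
        · simp [h]
    refine ⟨M ⊓ (lmul (a ⊓ q.1) b ⊔ lmul a (b ⊓ q.2)), ?_, ?_⟩
    · change M.1 ∩ (lmul (a ⊓ q.1) b ⊔ lmul a (b ⊓ q.2)).1 = _
      rw [hM, hval]
      ext p
      simp only [Finset.mem_insert, forall_eq_or_imp, Set.mem_inter_iff, Set.mem_ofPred_eq]
      tauto
    · have hr : θ'.r (lmul (a ⊓ q.1) b ⊔ lmul a (b ⊓ q.2)) (lmul a b) := by
        rw [← Theta_mem_collapsed_iff ha hb]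
        refine h ((Theta_mem_collapsed_iff ha hb).2 (con_of_le_of_le hH ?_ (mixed_le ha hb)))
        change pureTensor a b ∩ H.1 ⊆ (lmul (a ⊓ q.1) b ⊔ lmul a (b ⊓ q.2)).1
        rw [hval]
        exact Set.inter_subset_inter_right _ (hs q (Finset.mem_insert_self _ _))
      simpa using θ'.inf hMr hr

theorem r_lmul_of_collapsed_subset {θ θ' : LatticeCon (LatticeTensor A B)}
    (h : collapsed θ ⊆ collapsed θ') {H : LatticeTensor A B} {a : A} {b : B}
    (hH : θ.r (lmul a b ⊓ H) (lmul a b)) : θ'.r (lmul a b ⊓ H) (lmul a b) := by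
  obtain ⟨s, -, hs⟩ := H.2.1
  obtain ⟨M, hM, hr⟩ := collapsed_inf_box h hH s fun q hq p hp => by
    rw [hs] at hp
    exact hp q hq
  rw [← hs] at hM
  rwa [show M = lmul a b ⊓ H from Subtype.ext hM] at hr

theorem con_le_of_collapsed_subset {θ θ' : LatticeCon (LatticeTensor A B)}
    (h : collapsed θ ⊆ collapsed θ') : θ ≤ θ' := by
  classical
  refine con_le_of_forall_le fun H K hHK hr => ?_
  -- Climb from `H` to `K` inside one `θ'`-class by joining the pure tensors that make up `K` one at
  -- a time.
  have key : ∀ F : Finset (A × B), unionTensor F ⊆ K.1 → ∃ M : LatticeTensor A B,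
      θ'.r H M ∧ H ≤ M ∧ M ≤ K ∧ unionTensor F ⊆ M.1 := by
    intro F
    induction F using Finset.induction_on with
    | empty => exact fun _ => ⟨H, θ'.refl _, le_rfl, hHK, by simp [unionTensor]⟩
    | insert q F _ ih =>
      intro hF
      obtain ⟨M, hHM, hle, hMK, hM⟩ := ih fun p ⟨q, hq, hp⟩ =>
        hF ⟨q, Finset.mem_insert_of_mem hq, hp⟩
      have hq : lmul q.1 q.2 ≤ K := fun p hp => hF ⟨q, Finset.mem_insert_self _ _, hp⟩
      have hr' : θ'.r (lmul q.1 q.2 ⊓ H) (lmul q.1 q.2) := by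
        refine r_lmul_of_collapsed_subset h ?_
        simpa [inf_eq_left.2 hq] using con_inf_left hr (lmul q.1 q.2)
      refine ⟨M ⊔ lmul q.1 q.2, ?_, le_sup_of_le_left hle, sup_le hMK hq, ?_⟩
      · simpa [sup_eq_left.2 (inf_le_right : lmul q.1 q.2 ⊓ H ≤ H)] using θ'.sup hHM hr'
      · rintro p ⟨f, hf, hp⟩
        rcases Finset.mem_insert.1 hf with rfl | hf
        · exact (le_sup_right : lmul f.1 f.2 ≤ M ⊔ lmul f.1 f.2) hp
        · exact (le_sup_left : M ≤ M ⊔ lmul q.1 q.2) (hM ⟨f, hf, hp⟩)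
  obtain ⟨F, hF⟩ := exists_unionTensor_of_confined K.2.1 K.2.2
  obtain ⟨M, hHM, -, hMK, hM⟩ := key F hF.ge
  rwa [le_antisymm hMK (hF.le.trans hM : K.1 ⊆ M.1)] at hHM

end Forward

/-! ### Isomorphisms out of the tensor product are determined on principal congruences -/

section TensorIso

variable {A : Type u} {B : Type v} [Lattice A] [Lattice B]

theorem tmul_le_iff {s : ConC A} {t : ConC B} {I : SemilatticeTensor (ConC A) (ConC B)} :
    tmul s t ≤ I ↔ (s, t) ∈ I.1.carrier := pureBiIdeal_le_iff

theorem tensor_iso_ext {X : Type*} [PartialOrder X]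
    {μ ν : SemilatticeTensor (ConC A) (ConC B) ≃o X}
    (h : ∀ (a₀ a₁ : A) (b₀ b₁ : B), a₀ ≤ a₁ → b₀ ≤ b₁ →
      μ (tmul (Theta a₀ a₁) (Theta b₀ b₁)) = ν (tmul (Theta a₀ a₁) (Theta b₀ b₁))) :
    μ = ν := by
  have key : ∀ μ ν : SemilatticeTensor (ConC A) (ConC B) ≃o X,
      (∀ (a₀ a₁ : A) (b₀ b₁ : B), a₀ ≤ a₁ → b₀ ≤ b₁ →
        μ (tmul (Theta a₀ a₁) (Theta b₀ b₁)) = ν (tmul (Theta a₀ a₁) (Theta b₀ b₁))) →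
      ∀ I, μ I ≤ ν I := fun μ ν h I => by
    rw [← ν.symm_apply_le]
    refine biIdeal_le_of_Theta fun a₀ a₁ b₀ b₁ ha hb hmem => ?_
    have hle : tmul (Theta a₀ a₁) (Theta b₀ b₁) ≤ ν.symm (μ I) := tmul_le_iff.2 hmem
    rw [ν.le_symm_apply, ← h a₀ a₁ b₀ b₁ ha hb, μ.le_iff_le] at hle
    exact tmul_le_iff.1 hle
  exact OrderIso.ext (funext fun I => le_antisymm (key μ ν h I)
    (key ν μ (fun a₀ a₁ b₀ b₁ ha hb => (h a₀ a₁ b₀ b₁ ha hb).symm) I))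

end TensorIso

/-! ### The congruence of A ⊠ B given by a pair of congruences -/

section PairCon

variable {A : Type u} {B : Type v} [Lattice A] [Lattice B]

theorem MemBoxProd.isLowerSet {H : Set (A × B)} (hH : MemBoxProd H) : IsLowerSet H := by
  obtain ⟨s, _, rfl⟩ := hH
  exact fun p p' hp h q hq => (h q hq).imp hp.1.trans hp.2.trans

/-- Membership in a box modulo a pair of congruences. -/
def MemBoxMod (φ : LatticeCon A) (ψ : LatticeCon B) (p q : A × B) : Prop :=
  φ.r (p.1 ⊔ q.1) q.1 ∨ ψ.r (p.2 ⊔ q.2) q.2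

theorem memBoxMod_of_mem_box {φ : LatticeCon A} {ψ : LatticeCon B} {p p' q q' : A × B}
    (hp₁ : φ.r p.1 p'.1) (hp₂ : ψ.r p.2 p'.2) (hq₁ : φ.r q.1 q'.1) (hq₂ : ψ.r q.2 q'.2)
    (h : p' ∈ box q'.1 q'.2) : MemBoxMod φ ψ p q := by
  refine h.imp (fun h => ?_) fun h => ?_
  · exact φ.trans (φ.sup hp₁ hq₁) (by simpa [sup_eq_right.2 h] using φ.symm hq₁)
  · exact ψ.trans (ψ.sup hp₂ hq₂) (by simpa [sup_eq_right.2 h] using ψ.symm hq₂)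

/-- Boxes are lower sets, so the point can be moved into them successively by lowering, for each
box, one coordinate within its class. -/
theorem exists_mem_box_of_memBoxMod {φ : LatticeCon A} {ψ : LatticeCon B} {p : A × B}
    (s : Finset (A × B)) (h : ∀ q ∈ s, MemBoxMod φ ψ p q) :
    ∃ p' : A × B, φ.r p.1 p'.1 ∧ ψ.r p.2 p'.2 ∧ ∀ q ∈ s, p' ∈ box q.1 q.2 := by
  classical
  induction s using Finset.induction_on with
  | empty => exact ⟨p, φ.refl _, ψ.refl _, by simp⟩
  | insert q s _ ih =>
    obtain ⟨p', h₁, h₂, hs⟩ := ih fun q hq => h q (Finset.mem_insert_of_mem hq)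
    rcases h q (Finset.mem_insert_self _ _) with hq | hq
    · refine ⟨(p'.1 ⊓ q.1, p'.2), ?_, h₂, fun r hr => ?_⟩
      · simpa using φ.inf h₁ hq
      · rcases Finset.mem_insert.1 hr with rfl | hr
        · exact Or.inl inf_le_right
        · exact (hs r hr).imp inf_le_left.trans id
    · refine ⟨(p'.1, p'.2 ⊓ q.2), h₁, ?_, fun r hr => ?_⟩
      · simpa using ψ.inf h₂ hq
      · rcases Finset.mem_insert.1 hr with rfl | hr
        · exact Or.inr inf_le_right
        · exact (hs r hr).imp id inf_le_left.trans

variable [OrderBot A] [OrderBot B]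

/-- Dually, the box is enlarged within its classes, one coordinate for each generator of the union.
-/
theorem exists_box_of_memBoxMod {φ : LatticeCon A} {ψ : LatticeCon B} {q : A × B}
    (F : Finset (A × B)) (h : ∀ f ∈ F, MemBoxMod φ ψ f q) :
    ∃ q' : A × B, φ.r q.1 q'.1 ∧ ψ.r q.2 q'.2 ∧ unionTensor F ⊆ box q'.1 q'.2 := by
  classical
  induction F using Finset.induction_on with
  | empty => exact ⟨q, φ.refl _, ψ.refl _, by simp [unionTensor]⟩
  | insert f F _ ih =>
    obtain ⟨q', h₁, h₂, hF⟩ := ih fun f hf => h f (Finset.mem_insert_of_mem hf)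
    have key : ∀ x y, q'.1 ≤ x → q'.2 ≤ y → (f.1 ≤ x ∨ f.2 ≤ y) →
        unionTensor (insert f F) ⊆ box x y := by
      rintro x y hx hy hf p ⟨g, hg, hp⟩
      rcases Finset.mem_insert.1 hg with rfl | hg
      · exact pureTensor_subset_box.2 hf hp
      · exact (hF ⟨g, hg, hp⟩).imp (le_trans · hx) (le_trans · hy)
    rcases h f (Finset.mem_insert_self _ _) with hf | hf
    · exact ⟨(f.1 ⊔ q'.1, q'.2), φ.trans (φ.symm hf) (con_sup_left h₁ _), h₂,
        key _ _ le_sup_right le_rfl (Or.inl le_sup_left)⟩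
    · exact ⟨(q'.1, f.2 ⊔ q'.2), h₁, ψ.trans (ψ.symm hf) (con_sup_left h₂ _),
        key _ _ le_rfl le_sup_right (Or.inr le_sup_left)⟩

/-- Containment of elements of `A ⊠ B` modulo a pair of congruences. -/
def LeMod (φ : LatticeCon A) (ψ : LatticeCon B) (H K : LatticeTensor A B) : Prop :=
  ∀ p ∈ H.1, ∃ p' ∈ K.1, φ.r p.1 p'.1 ∧ ψ.r p.2 p'.2

variable {φ : LatticeCon A} {ψ : LatticeCon B} {H H' K K' M : LatticeTensor A B}

theorem LeMod.of_le (h : H ≤ K) : LeMod φ ψ H K :=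
  fun p hp => ⟨p, h hp, φ.refl _, ψ.refl _⟩

theorem LeMod.trans (h₁ : LeMod φ ψ H K) (h₂ : LeMod φ ψ K M) : LeMod φ ψ H M := by
  intro p hp
  obtain ⟨q, hq, h, h'⟩ := h₁ p hp
  obtain ⟨r, hr, k, k'⟩ := h₂ q hq
  exact ⟨r, hr, φ.trans h k, ψ.trans h' k'⟩

theorem LeMod.inf (h₁ : LeMod φ ψ M H) (h₂ : LeMod φ ψ M K) : LeMod φ ψ M (H ⊓ K) := by
  intro p hp
  obtain ⟨q, hq, h, h'⟩ := h₁ p hp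
  obtain ⟨r, hr, k, k'⟩ := h₂ p hp
  refine ⟨q ⊓ r, ⟨H.2.1.isLowerSet inf_le_left hq, K.2.1.isLowerSet inf_le_right hr⟩, ?_, ?_⟩
  · simpa using φ.inf h k
  · simpa using ψ.inf h' k'

theorem LeMod.exists_box (h : LeMod φ ψ H M) {q : A × B} (hM : M.1 ⊆ box q.1 q.2) :
    ∃ q' : A × B, φ.r q.1 q'.1 ∧ ψ.r q.2 q'.2 ∧ H.1 ⊆ box q'.1 q'.2 := by
  obtain ⟨F, hF⟩ := exists_unionTensor_of_confined H.2.1 H.2.2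
  rw [hF]
  refine exists_box_of_memBoxMod F fun f hf => ?_
  obtain ⟨p, hp, h₁, h₂⟩ := h f (hF ▸ ⟨f, hf, Or.inl ⟨le_rfl, le_rfl⟩⟩)
  exact memBoxMod_of_mem_box h₁ h₂ (φ.refl _) (ψ.refl _) (hM hp)

/-- Every box over `M` can be enlarged within its classes to contain both `H` and `K`, hence their
box closure. A point of the join therefore lies in each box defining `M` modulo the congruences, and
finitely many such boxes can be met by one representative. -/
theorem LeMod.sup (h₁ : LeMod φ ψ H M) (h₂ : LeMod φ ψ K M) : LeMod φ ψ (H ⊔ K) M := by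
  intro p hp
  obtain ⟨s, -, hs⟩ := M.2.1
  rw [hs]
  suffices hmod : ∀ q ∈ s, MemBoxMod φ ψ p q by
    obtain ⟨p', h, h', hp'⟩ := exists_mem_box_of_memBoxMod s hmod
    exact ⟨p', hp', h, h'⟩
  · intro q hq
    have hM : M.1 ⊆ box q.1 q.2 := by
      rw [hs]
      exact fun r hr => hr q hq
    obtain ⟨x, hx₁, hx₂, hx⟩ := h₁.exists_box hM
    obtain ⟨y, hy₁, hy₂, hy⟩ := h₂.exists_box hM
    refine memBoxMod_of_mem_box (φ.refl _) (ψ.refl _) (q' := x ⊔ y) ?_ ?_ (hp _ _ ?_)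
    · simpa using φ.sup hx₁ hy₁
    · simpa using ψ.sup hx₂ hy₂
    · rintro r (hr | hr)
      · exact (hx hr).imp (le_sup_of_le_left ·) (le_sup_of_le_left ·)
      · exact (hy hr).imp (le_sup_of_le_right ·) (le_sup_of_le_right ·)

/-- The kernel of the canonical map from `A ⊠ B` to `(A / φ) ⊠ (B / ψ)`. -/
def pairCon (φ : LatticeCon A) (ψ : LatticeCon B) : LatticeCon (LatticeTensor A B) where
  r H K := LeMod φ ψ H K ∧ LeMod φ ψ K H
  iseqv :=
    { refl := fun _ => ⟨.of_le le_rfl, .of_le le_rfl⟩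
      symm := And.symm
      trans := fun h₁ h₂ => ⟨h₁.1.trans h₂.1, h₂.2.trans h₁.2⟩ }
  inf := fun h₁ h₂ =>
    ⟨.inf (.trans (.of_le inf_le_left) h₁.1) (.trans (.of_le inf_le_right) h₂.1),
      .inf (.trans (.of_le inf_le_left) h₁.2) (.trans (.of_le inf_le_right) h₂.2)⟩
  sup := fun h₁ h₂ =>
    ⟨.sup (.trans h₁.1 (.of_le le_sup_left)) (.trans h₂.1 (.of_le le_sup_right)),
      .sup (.trans h₁.2 (.of_le le_sup_left)) (.trans h₂.2 (.of_le le_sup_right))⟩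

/-- A point equivalent to (a₁, b₁) inside a₀ □ b₀ forces one interval to collapse, by convexity.
Conversely, meeting the matching coordinate with a₀ or b₀ moves points of a₁ ⊠ b₁ into the mixed
tensor. -/
theorem pairCon_mixed_iff {a₀ a₁ : A} {b₀ b₁ : B} (ha : a₀ ≤ a₁) (hb : b₀ ≤ b₁) :
    (pairCon φ ψ).r (lmul a₀ b₁ ⊔ lmul a₁ b₀) (lmul a₁ b₁) ↔ φ.r a₀ a₁ ∨ ψ.r b₀ b₁ := by
  constructor
  · rintro ⟨-, h⟩
    obtain ⟨p, hp, h₁, h₂⟩ := h (a₁, b₁) (Or.inl ⟨le_rfl, le_rfl⟩)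
    rw [mixed_val ha hb] at hp
    refine hp.2.imp (fun h => ?_) fun h => ?_
    · exact con_of_le_of_le (φ.symm h₁) h ha
    · exact con_of_le_of_le (ψ.symm h₂) h hb
  · refine fun h => ⟨.of_le (mixed_le ha hb), fun p hp => ?_⟩
    rw [mixed_val ha hb]
    rcases hp with hp | hp
    · rcases h with h | h
      · refine ⟨(p.1 ⊓ a₀, p.2), ⟨Or.inl ⟨inf_le_right.trans ha, hp.2⟩, Or.inl inf_le_right⟩, ?_,
          ψ.refl _⟩
        simpa [inf_eq_left.2 hp.1] using con_inf_left (φ.symm h) p.1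
      · refine ⟨(p.1, p.2 ⊓ b₀), ⟨Or.inl ⟨hp.1, inf_le_right.trans hb⟩, Or.inr inf_le_right⟩,
          φ.refl _, ?_⟩
        simpa [inf_eq_left.2 hp.2] using con_inf_left (ψ.symm h) p.2
    · exact ⟨p, ⟨Or.inr hp, hp.imp (fun h' => h'.trans_le bot_le)
        fun h' => h'.trans_le bot_le⟩,
        φ.refl _, ψ.refl _⟩

end PairCon

/-! ### The isomorphism with bi-ideals and its restriction to compact elements -/

section Isomorphism

variable {A : Type u} {B : Type v} [Lattice A] [Lattice B] [OrderBot A] [OrderBot B]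

theorem collapsedBiIdeal_surjective :
    Function.Surjective (collapsedBiIdeal : LatticeCon (LatticeTensor A B) → _) := by
  intro I
  -- The preimage of `I` is the intersection of the kernels for all pairs (p, q) whose associated
  -- set of pairs contains `I`.
  refine ⟨sInf {θ | ∃ p q, (∀ x y, (x, y) ∈ I.carrier → x.1 ≤ p ∨ y.1 ≤ q) ∧ θ = pairCon p q},
    le_antisymm ?_ ?_⟩
  · rintro ⟨s, t⟩ hst
    by_contra hI
    obtain ⟨p, q, hp, hq, hpq⟩ := exists_con_of_notMem hI
    obtain ⟨a₀, a₁, ha, has, hap⟩ := exists_le_of_not_le hp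
    obtain ⟨b₀, b₁, hb, hbt, hbq⟩ := exists_le_of_not_le hq
    exact ((pairCon_mixed_iff ha hb).1 (hst a₀ a₁ b₀ b₁ ha hb has hbt _ ⟨p, q, hpq, rfl⟩)).elim
      hap hbq
  · rintro ⟨s, t⟩ hst a₀ a₁ b₀ b₁ ha hb hs ht _ ⟨p, q, hpq, rfl⟩
    exact (pairCon_mixed_iff ha hb).2 ((hpq s t hst).imp (fun h => h _ _ hs) fun h => h _ _ ht)

variable (A B) in
/-- The congruence lattice of `A ⊠ B` is isomorphic to the lattice of bi-ideals of compact
congruences. -/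
noncomputable def conEquivBiIdeal : LatticeCon (LatticeTensor A B) ≃o BiIdeal (ConC A) (ConC B) :=
  RelIso.ofSurjective (OrderEmbedding.ofMapLEIff collapsedBiIdeal fun _ _ =>
    ⟨con_le_of_collapsed_subset, fun h _ hp a₀ a₁ b₀ b₁ ha hb hs ht =>
      h _ _ (hp a₀ a₁ b₀ b₁ ha hb hs ht)⟩) collapsedBiIdeal_surjective

theorem isCompactElement_map {P Q : Type*} [CompleteLattice P] [CompleteLattice Q] (e : P ≃o Q)
    {k : P} (hk : IsCompactElement k) : IsCompactElement (e k) := by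
  intro s u hs hd hu hle
  obtain ⟨_, ⟨x, hx, rfl⟩, hkx⟩ := hk (e.symm '' s) (e.symm u) (hs.image _)
    (by
      rintro _ ⟨x, hx, rfl⟩ _ ⟨y, hy, rfl⟩
      obtain ⟨z, hz, hxz, hyz⟩ := hd x hx y hy
      exact ⟨_, ⟨z, hz, rfl⟩, e.symm.monotone hxz, e.symm.monotone hyz⟩)
    (e.symm.isLUB_image'.2 hu) (e.le_symm_apply.2 hle)
  exact ⟨x, hx, e.le_symm_apply.1 hkx⟩

/-- An isomorphism of complete lattices restricts to the compact elements. -/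
def CompactElts.mapIso {P : Type u} {Q : Type v} [CompleteLattice P] [CompleteLattice Q]
    (e : P ≃o Q) : CompactElts P ≃o CompactElts Q where
  toFun k := ⟨e k.1, isCompactElement_map e k.2⟩
  invFun k := ⟨e.symm k.1, isCompactElement_map e.symm k.2⟩
  left_inv k := Subtype.ext (e.symm_apply_apply k.1)
  right_inv k := Subtype.ext (e.apply_symm_apply k.1)
  map_rel_iff' := e.map_rel_iff

end Isomorphism

end LatTensor

theorem mainTheorem3 {A : Type*} {B : Type*} [Lattice A] [OrderBot A] [Lattice B] [OrderBot B] :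
    ∃! μ : LatTensor.SemilatticeTensor (LatTensor.ConC A) (LatTensor.ConC B) ≃o
        LatTensor.ConC (LatTensor.LatticeTensor A B),
      ∀ (a₀ a₁ : A) (b₀ b₁ : B), a₀ ≤ a₁ → b₀ ≤ b₁ →
        μ (LatTensor.tmul (LatTensor.Theta a₀ a₁) (LatTensor.Theta b₀ b₁)) =
          LatTensor.Theta (LatTensor.lmul a₀ b₁ ⊔ LatTensor.lmul a₁ b₀)
            (LatTensor.lmul a₁ b₁) := by
  have hμ : ∀ (a₀ a₁ : A) (b₀ b₁ : B), a₀ ≤ a₁ → b₀ ≤ b₁ →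
      LatTensor.CompactElts.mapIso (LatTensor.conEquivBiIdeal A B).symm
        (LatTensor.tmul (LatTensor.Theta a₀ a₁) (LatTensor.Theta b₀ b₁)) =
          LatTensor.Theta (LatTensor.lmul a₀ b₁ ⊔ LatTensor.lmul a₁ b₀)
            (LatTensor.lmul a₁ b₁) := by
    intro a₀ a₁ b₀ b₁ ha hb
    -- Both sides have the same upper bounds: `θ` lies above either one exactly when it collapses
    -- the mixed tensor.
    refine Subtype.ext (eq_of_forall_ge_iff fun θ => ?_)
    exact (LatTensor.conEquivBiIdeal A B).symm_apply_le.trans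
      (LatTensor.pureBiIdeal_le_iff.trans
        ((LatTensor.Theta_mem_collapsed_iff ha hb).trans LatTensor.principalCon_le_iff.symm))
  refine ⟨_, hμ, fun ν hν => LatTensor.tensor_iso_ext fun a₀ a₁ b₀ b₁ ha hb => ?_⟩
  rw [hν a₀ a₁ b₀ b₁ ha hb, hμ a₀ a₁ b₀ b₁ ha hb]
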